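/- Let $n,m\ge 0$, $r\in\mathbb R^n$, integers $0\le L_i\le U_i$ and $d_i:=U_i-L_i$ for $i\in[n]$, $A\in\mathbb R^{m\times n}$, $b\in\mathbb R^m$, and $$X:=\{x\in\mathbb Z_+^n \mid L_i\le x_i\le U_i\ (i\in[n]),\ Ax\ge b\}.$$ For attraction functions $f_1,\dots,f_n$ defined on the inventory levels let $\pi_i(x)=\dfrac{f_i(x_i)}{1+\sum_{j=1}^n f_j(x_j)}$, and consider the inventory optimization problem $$\max\Bigl\{\sum_{i=1}^n r_i\pi_i(x)\ \Big|\ x\in X\Bigr\};\tag{Inv-Choice}$$ the inventory-dependent MNL model of Boada et al. is the case $f_i(y)=v_i e^{\psi(y)}$ with $v_i>0$ and a univariate function $\psi$. Write $\delta_{it}:=f_i(L_i+t)-f_i(L_i+t-1)$ for $t\in[d_i]$. Formulation (inv-IP), in the variables $x,\rho,\mu,s,z,Z$, is: maximize $\sum_{i} r_i\mu_i$ subject to $$\begin{aligned} &Ax\ge b,\quad x_i=L_i+\sum_{j}z_{ij},\quad 1\ge z_{i1}\ge\dots\ge z_{id_i}\ge 0,\quad z_{ij}\in\{0,1\},\\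 &\rho+\sum_{i}\mu_i=1,\qquad \mu_k=f_k(L_k)\rho+\sum_{j\in[d_k]}\delta_{kj}s_{kj},\qquad \rho\ge s_{i1}\ge\dots\ge s_{id_i}\ge 0,\\ &A\bigl(L_i\rho+\textstyle\sum_j s_{ij}\bigr)_{i\in[n]}\ge b\rho,\qquad z_{kj}=s_{kj}+\sum_{i\in[n]}Z^k_{ij},\\ &Z^k_{ij}\le \min_{0\le\tau\le d_i}\Bigl\{f_i(L_i+\tau)s_{kj}+\sum_{t>\tau}\delta_{it}s_{it}\Bigr\}\quad(i\ne k),\\ &Z^k_{ij}\ge \max_{0\le\tau\le d_i}\Bigl\{f_i(L_i)\rho+\sum_{1\le t\le\tau}\delta_{it}s_{it}+f_i(L_i+\tau)s_{kj}-f_i(L_i+\tau)\rho\Bigr\}\quad(i\ne k),\\ &Z^k_{kj}=f_k(L_k+j)s_{kj}+\sum_{t>j}\delta_{kt}s_{kt}, \end{aligned}$$ for all $i,k\in[n]$ and all $j$ in the relevant range ($[d_i]$ for $z_{ij},s_{ij}$ and $[d_k]$ for $z_{kj},s_{kj},Z^k_{ij}$). Its LP relaxation drops the requirement $z_{ij}\in\{0,1\}$.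 (1) Suppose that each $f_i$ is nondecreasing on $\{L_i,\dots,U_i\}$ and that $1+\sum_i f_i(x_i)>0$ for all $x\in\prod_i\{L_i,\dots,U_i\}$. Then (inv-IP) is an MIP formulation of (Inv-Choice): the feasible set of its LP relaxation is a polyhedron, and the projection of the feasible set of (inv-IP) onto the $(x,\mu)$-space is $\{(x,\pi(x))\mid x\in X\}$. In particular, the optimal solutions of (Inv-Choice) are exactly the $x$-parts of the optimal solutions of (inv-IP). (2) Let $f_i(y)=v_ie^{\psi(y)}$ with $v_i>0$, and suppose that $\{y\in\mathbb R^n\mid L\le y\le U,\ Ay\ge b\}=\{y\in\mathbb R^n\mid L\le y\le U,\ \sum_{j}y_j\le\bar I\}$ for an integer $\bar I$. If $e^{\psi(\cdot)}$ is concave on $[0,\infty)$ (hence nondecreasing there) or, more generally, for each $i$ concave on $[L_i,U_i]$ and nondecreasing on $\{L_i,\dots,U_i\}$, then the LP relaxation of (inv-IP) solves (Inv-Choice): it is feasible if and only if $X\ne\emptyset$; if $X\ne\emptyset$, then both problems attain their maxima and these are equal; and the optimal solutions of (Inv-Choice) are exactly the $x$-parts of those optimal solutions of the LP relaxation in which $z$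 is binary. -/

import Mathlib

open scoped Matrix

noncomputable section

/-! ### Polyhedra, MIP formulations, optimal solutions -/

/-- A polyhedron in `ℝ^ι`: the solution set of finitely many (weak) linear inequalities. -/
def IsPolyhedron {ι : Type*} (Q : Set (ι → ℝ)) : Prop :=
  ∃ (p : ℕ) (a : Fin p → ((ι → ℝ) →ₗ[ℝ] ℝ)) (c : Fin p → ℝ), Q = {v | ∀ t, a t v ≤ c t}

/-- The points of `Q` whose coordinates indexed by `B` are binary. -/
def binaryPoints {ι : Type*} (Q : Set (ι → ℝ)) (B : Set ι) : Set (ι → ℝ) :=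
  {v | v ∈ Q ∧ ∀ i ∈ B, v i = 0 ∨ v i = 1}

/-- Imposing binary conditions on the coordinates `B` of the polyhedron `Q` gives an MIP
formulation of `S`: the projection of the resulting set onto the coordinates selected by `e`
is `S`. The set `Q` itself is the LP relaxation. -/
def IsMIPFormulation {ι κ : Type*} (Q : Set (ι → ℝ)) (B : Set ι) (e : κ → ι)
    (S : Set (κ → ℝ)) : Prop :=
  IsPolyhedron Q ∧ (fun v : ι → ℝ => v ∘ e) '' binaryPoints Q B = S

/-- `a` is an optimal solution of `max {g y | y ∈ S}`. -/
def IsOptimal {α : Type*} (S : Set α) (g : α → ℝ) (a : α) : Prop :=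
  a ∈ S ∧ IsMaxOn g S a

/-! ### Inventory optimization under a choice model -/

/-- The attraction `v_i * exp (ψ (x_i))` of product `i` at inventory level `x_i`. -/
def attraction {n : ℕ} (v : Fin n → ℝ) (ψ : ℝ → ℝ) (i : Fin n) (x : ℕ) : ℝ :=
  v i * Real.exp (ψ x)

/-- The probability that product `i` is purchased at the inventory vector `x`, when the
attraction of product `j` at level `y` is `f j y`. -/
def choiceProb {n : ℕ} (f : Fin n → ℕ → ℝ) (x : Fin n → ℕ) (i : Fin n) : ℝ :=
  f i (x i) / (1 + ∑ j, f j (x j))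

/-- Expected sales at the inventory vector `x`. -/
def expectedSales {n : ℕ} (r : Fin n → ℝ) (f : Fin n → ℕ → ℝ) (x : Fin n → ℕ) : ℝ :=
  ∑ i, r i * choiceProb f x i

/-- Feasible inventory vectors: `x ∈ ℤ₊ⁿ`, `L ≤ x ≤ U`, `A x ≥ b`. -/
def invFeasible {n m : ℕ} (L U : Fin n → ℕ) (A : Matrix (Fin m) (Fin n) ℝ) (b : Fin m → ℝ) :
    Set (Fin n → ℕ) :=
  {x | (∀ i, L i ≤ x i ∧ x i ≤ U i) ∧ b ≤ A *ᵥ (fun i => (x i : ℝ))}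

/-- The set of pairs (inventory vector, purchase probabilities) over the feasible inventory
vectors; the first summand indexes inventories, the second one probabilities. -/
def invGraph {n m : ℕ} (L U : Fin n → ℕ) (A : Matrix (Fin m) (Fin n) ℝ) (b : Fin m → ℝ)
    (f : Fin n → ℕ → ℝ) : Set (Fin n ⊕ Fin n → ℝ) :=
  {w | ∃ x ∈ invFeasible L U A b,
    (∀ i, w (Sum.inl i) = (x i : ℝ)) ∧ ∀ i, w (Sum.inr i) = choiceProb f x i}

/-! ### The formulation -/

/-- The variables `x_i`, `ρ`, `μ_i`, `s_{ij}`, `z_{ij}`, `Z^k_{ij}` of the formulation, where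
`d_i = U_i - L_i`. An index `j : Fin d_i` stands for `j + 1 ∈ {1, …, d_i}`. -/
inductive InvVar {n : ℕ} (L U : Fin n → ℕ) : Type
  | x (i : Fin n)
  | rho
  | mu (i : Fin n)
  | s (i : Fin n) (j : Fin (U i - L i))
  | z (i : Fin n) (j : Fin (U i - L i))
  | Z (k i : Fin n) (j : Fin (U k - L k))

/-- The scaled unary simplex `c ≥ y_1 ≥ y_2 ≥ ⋯ ≥ y_d ≥ 0`. -/
def InUnarySimplex {d : ℕ} (c : ℝ) (y : Fin d → ℝ) : Prop :=
  0 ≤ c ∧ Antitone y ∧ ∀ j, 0 ≤ y j ∧ y j ≤ c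

/-- The increment `f_i (L_i + t + 1) - f_i (L_i + t)`. -/
def levelInc {n : ℕ} (L : Fin n → ℕ) (f : Fin n → ℕ → ℝ) (i : Fin n) (t : ℕ) : ℝ :=
  f i (L i + t + 1) - f i (L i + t)

/-- The linear constraints of the formulation (all constraints but the binary ones). -/
structure InvLPFeasible {n m : ℕ} (L U : Fin n → ℕ) (A : Matrix (Fin m) (Fin n) ℝ)
    (b : Fin m → ℝ) (f : Fin n → ℕ → ℝ) (v : InvVar L U → ℝ) : Prop where
  /-- `A x ≥ b` -/
  poly : b ≤ A *ᵥ (fun i => v (.x i))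
  /-- `x_i = L_i + 1ᵀ z_i` -/
  x_eq : ∀ i, v (.x i) = (L i : ℝ) + ∑ j, v (.z i j)
  /-- `1 ≥ z_{i1} ≥ ⋯ ≥ z_{id_i} ≥ 0` -/
  z_mem : ∀ i, InUnarySimplex 1 (fun j => v (.z i j))
  /-- `ρ + ∑ μ_i = 1` -/
  total : v .rho + ∑ i, v (.mu i) = 1
  /-- `μ_k = f_k(L_k) ρ + ∑_j (f_k(L_k+j) - f_k(L_k+j-1)) s_{kj}` -/
  mu_eq : ∀ k, v (.mu k) = f k (L k) * v .rho + ∑ j : Fin (U k - L k), levelInc L f k j * v (.s k j)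
  /-- `A (L_i ρ + 1ᵀ s_i)_i ≥ b ρ` -/
  scaled : (fun t => b t * v .rho) ≤ A *ᵥ (fun i => (L i : ℝ) * v .rho + ∑ j, v (.s i j))
  /-- `ρ ≥ s_{i1} ≥ ⋯ ≥ s_{id_i} ≥ 0` -/
  s_mem : ∀ i, InUnarySimplex (v .rho) (fun j => v (.s i j))
  /-- `z_{kj} = s_{kj} + ∑_i Z^k_{ij}` -/
  z_eq : ∀ k j, v (.z k j) = v (.s k j) + ∑ i, v (.Z k i j)
  /-- `Z^k_{ij} ≤ min_{0 ≤ τ ≤ d_i}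
  { f_i(L_i+τ) s_{kj} + ∑_{t > τ} (f_i(L_i+t) - f_i(L_i+t-1)) s_{it} }` for `i ≠ k` -/
  Z_le : ∀ k i j, i ≠ k → ∀ τ : ℕ, τ ≤ U i - L i →
    v (.Z k i j) ≤ f i (L i + τ) * v (.s k j) +
      ∑ t : Fin (U i - L i), if τ ≤ (t : ℕ) then levelInc L f i t * v (.s i t) else 0
  /-- `Z^k_{ij} ≥ max_{0 ≤ τ ≤ d_i}
  { f_i(L_i) ρ + ∑_{1 ≤ t ≤ τ} (f_i(L_i+t) - f_i(L_i+t-1)) s_{it} + f_i(L_i+τ) s_{kj}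
  - f_i(L_i+τ) ρ }` for `i ≠ k` -/
  Z_ge : ∀ k i j, i ≠ k → ∀ τ : ℕ, τ ≤ U i - L i →
    f i (L i) * v .rho +
      (∑ t : Fin (U i - L i), if (t : ℕ) < τ then levelInc L f i t * v (.s i t) else 0) +
      f i (L i + τ) * v (.s k j) - f i (L i + τ) * v .rho ≤ v (.Z k i j)
  /-- `Z^k_{kj} = f_k(L_k+j) s_{kj} + ∑_{t > j} (f_k(L_k+t) - f_k(L_k+t-1)) s_{kt}` -/
  Z_self : ∀ k j, v (.Z k k j) = f k (L k + j + 1) * v (.s k j) +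
    ∑ t : Fin (U k - L k), if j < t then levelInc L f k t * v (.s k t) else 0

/-- Feasible region of the LP relaxation. -/
def invLP {n m : ℕ} (L U : Fin n → ℕ) (A : Matrix (Fin m) (Fin n) ℝ) (b : Fin m → ℝ)
    (f : Fin n → ℕ → ℝ) : Set (InvVar L U → ℝ) :=
  {v | InvLPFeasible L U A b f v}

/-- The binary variables `z_{ij}`. -/
def invBinary {n : ℕ} (L U : Fin n → ℕ) : Set (InvVar L U) :=
  {q | ∃ i j, q = .z i j}

/-- Feasible region of the mixed-integer formulation. -/
def invIP {n m : ℕ} (L U : Fin n → ℕ) (A : Matrix (Fin m) (Fin n) ℝ) (b : Fin m → ℝ)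
    (f : Fin n → ℕ → ℝ) : Set (InvVar L U → ℝ) :=
  binaryPoints (invLP L U A b f) (invBinary L U)

/-- The linear objective `∑ r_i μ_i`. -/
def invObj {n : ℕ} (L U : Fin n → ℕ) (r : Fin n → ℝ) (v : InvVar L U → ℝ) : ℝ :=
  ∑ i, r i * v (.mu i)

end

/-! ### Polyhedra cut out by affine functions -/

/-! Exactness: an inventory vector `x` lifts to the point with `ρ = 1/(1+∑ f_j(x_j))`, `z` the unary
code of `x - L`, `s = ρ z` and `Z^k_{ij} = f_i(x_i) s_{kj}`; monotonicity of `f_i` gives the bounds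
on `Z` (`invLift_mem_invIP`). Conversely, summing the `τ = 0` bounds on `Z` over `i` gives `C s ≤ z
≤ 1 + C (s - ρ)` with `C = 1 + ∑ f_i(L_i) > 0` (`InvLPFeasible.z_bounds`). For binary `z` this
forces `s = ρ z`; then the increments telescope to `μ_i = f_i(x_i) ρ`, and `ρ + ∑ μ_i = 1`
determines `ρ`.

Tightness under a cap: let `λ` be the value of an LP point. As in parametric fractional programming,
`x` earns at least `λ` iff `∑ (r_i - λ) f_i(x_i) ≥ λ`. The vector `s/ρ` attains equality in the
version linearized by the increments, and it respects the cap. Concavity makes the increments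
decrease along each row, so a greedy integral filling of this unit-weight knapsack does at least as
well (`exists_integral_knapsack`). The variables `z` and `Z` play no role here. -/

theorem isPolyhedron_univ {ι : Type*} : IsPolyhedron (Set.univ : Set (ι → ℝ)) :=
  ⟨0, fun t => t.elim0, fun t => t.elim0, by
    ext v
    simp only [Set.mem_univ, Set.mem_ofPred_eq, true_iff]
    exact fun t => t.elim0⟩

theorem IsPolyhedron.setOf_forall {ι τ : Type*} [Finite τ] {P : τ → (ι → ℝ) → Prop}
    (h : ∀ t, IsPolyhedron {v | P t v}) : IsPolyhedron {v | ∀ t, P t v} := by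
  choose p a c hp using h
  obtain ⟨N, ⟨e⟩⟩ := Finite.exists_equiv_fin (Σ t, Fin (p t))
  refine ⟨N, fun q => a (e.symm q).1 (e.symm q).2, fun q => c (e.symm q).1 (e.symm q).2, ?_⟩
  have hp' : ∀ t v, P t v ↔ ∀ q, a t q v ≤ c t q := fun t v => Set.ext_iff.1 (hp t) v
  ext v
  simp only [Set.mem_ofPred_eq, hp']
  refine ⟨fun h q => h _ _, fun h t q => ?_⟩
  obtain ⟨u, hu⟩ : ∃ u, e.symm u = ⟨t, q⟩ := e.symm.surjective _
  have := h u
  rwa [hu] at this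

theorem IsPolyhedron.setOf_and {ι : Type*} {P Q : (ι → ℝ) → Prop}
    (hP : IsPolyhedron {v | P v}) (hQ : IsPolyhedron {v | Q v}) :
    IsPolyhedron {v | P v ∧ Q v} := by
  have := IsPolyhedron.setOf_forall (P := fun (t : Bool) v => if t then P v else Q v)
    (by rintro (_ | _) <;> simpa)
  convert this using 2
  ext v
  simp [and_comm]

theorem IsPolyhedron.setOf_imp {ι : Type*} {p : Prop} {P : (ι → ℝ) → Prop}
    (h : p → IsPolyhedron {v | P v}) : IsPolyhedron {v | p → P v} := by
  by_cases hp : p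
  · simpa [hp] using h hp
  · simpa [hp] using isPolyhedron_univ

theorem IsPolyhedron.setOf_forall_le {ι : Type*} {d : ℕ} {P : ℕ → (ι → ℝ) → Prop}
    (h : ∀ t, IsPolyhedron {v | P t v}) : IsPolyhedron {v | ∀ t ≤ d, P t v} := by
  have := IsPolyhedron.setOf_forall (P := fun (t : Fin (d + 1)) v => P t v) (fun t => h t)
  convert this using 2
  ext v
  exact ⟨fun H t => H t (Nat.lt_succ_iff.1 t.2), fun H t ht => H ⟨t, Nat.lt_succ_iff.2 ht⟩⟩

/-- Affine functions on `ℝ^ι`. -/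
def IsAffineFun {ι : Type*} (F : (ι → ℝ) → ℝ) : Prop :=
  ∃ (a : (ι → ℝ) →ₗ[ℝ] ℝ) (c : ℝ), ∀ v, F v = a v + c

namespace IsAffineFun

variable {ι : Type*} {F G : (ι → ℝ) → ℝ}

theorem coord (i : ι) : IsAffineFun (fun v : ι → ℝ => v i) :=
  ⟨LinearMap.proj i, 0, fun v => by simp⟩

theorem const (c : ℝ) : IsAffineFun (fun _ : ι → ℝ => c) := ⟨0, c, fun v => by simp⟩

theorem add (hF : IsAffineFun F) (hG : IsAffineFun G) : IsAffineFun (fun v => F v + G v) := by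
  obtain ⟨a, c, h⟩ := hF
  obtain ⟨a', c', h'⟩ := hG
  exact ⟨a + a', c + c', fun v => by simp only [h, h', LinearMap.add_apply]; ring⟩

theorem const_mul (k : ℝ) (hF : IsAffineFun F) : IsAffineFun (fun v => k * F v) := by
  obtain ⟨a, c, h⟩ := hF
  exact ⟨k • a, k * c, fun v => by simp only [h, LinearMap.smul_apply, smul_eq_mul]; ring⟩

theorem sub (hF : IsAffineFun F) (hG : IsAffineFun G) : IsAffineFun (fun v => F v - G v) := by
  obtain ⟨a, c, h⟩ := hF
  obtain ⟨a', c', h'⟩ := hG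
  exact ⟨a - a', c - c', fun v => by simp only [h, h', LinearMap.sub_apply]; ring⟩

theorem sum {τ : Type*} [Fintype τ] {F : τ → (ι → ℝ) → ℝ} (h : ∀ t, IsAffineFun (F t)) :
    IsAffineFun (fun v => ∑ t, F t v) := by
  choose a c h using h
  exact ⟨∑ t, a t, ∑ t, c t, fun v => by
    simp only [h, Finset.sum_add_distrib, LinearMap.sum_apply]⟩

theorem mulVec {m n : ℕ} (A : Matrix (Fin m) (Fin n) ℝ) {F : Fin n → (ι → ℝ) → ℝ}
    (h : ∀ i, IsAffineFun (F i)) (t : Fin m) : IsAffineFun (fun v => (A *ᵥ fun i => F i v) t) :=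
  sum fun i => const_mul (A t i) (h i)

theorem ite_zero (p : Prop) [Decidable p] (h : IsAffineFun F) :
    IsAffineFun (fun v => if p then F v else 0) := by
  by_cases hp : p
  · simpa [hp] using h
  · simpa [hp] using const 0

theorem _root_.IsPolyhedron.setOf_le (hF : IsAffineFun F) (hG : IsAffineFun G) :
    IsPolyhedron {v | F v ≤ G v} := by
  obtain ⟨a, c, h⟩ := hF.sub hG
  refine ⟨1, fun _ => a, fun _ => -c, ?_⟩
  ext v
  have := h v
  simp only [Set.mem_ofPred_eq, forall_const]
  constructor <;> intro _ <;> linarith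

theorem _root_.IsPolyhedron.setOf_eq (hF : IsAffineFun F) (hG : IsAffineFun G) :
    IsPolyhedron {v | F v = G v} := by
  simp only [le_antisymm_iff]
  exact .setOf_and (.setOf_le hF hG) (.setOf_le hG hF)

theorem _root_.IsPolyhedron.setOf_unarySimplex {d : ℕ} {y : Fin d → (ι → ℝ) → ℝ} (hF : IsAffineFun F)
    (hy : ∀ j, IsAffineFun (y j)) :
    IsPolyhedron {v | InUnarySimplex (F v) (fun j => y j v)} :=
  .setOf_and (.setOf_le (const 0) hF) <| .setOf_and
    (.setOf_forall fun i => .setOf_forall fun j =>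
      .setOf_imp fun _ => .setOf_le (hy j) (hy i))
    (.setOf_forall fun j => .setOf_and (.setOf_le (const 0) (hy j))
      (.setOf_le (hy j) hF))

end IsAffineFun

theorem isPolyhedron_invLP {n m : ℕ} (L U : Fin n → ℕ) (A : Matrix (Fin m) (Fin n) ℝ)
    (b : Fin m → ℝ) (f : Fin n → ℕ → ℝ) : IsPolyhedron (invLP L U A b f) := by
  -- The structure is unfolded into a conjunction so that the closure rules for polyhedra apply
  -- factor by factor.
  have key : invLP L U A b f = {v : InvVar L U → ℝ | (b ≤ A *ᵥ (fun i => v (.x i))) ∧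
      (∀ i, v (.x i) = (L i : ℝ) + ∑ j, v (.z i j)) ∧
      (∀ i, InUnarySimplex 1 (fun j => v (.z i j))) ∧
      (v .rho + ∑ i, v (.mu i) = 1) ∧
      (∀ k, v (.mu k) = f k (L k) * v .rho +
        ∑ j : Fin (U k - L k), levelInc L f k j * v (.s k j)) ∧
      ((fun t => b t * v .rho) ≤ A *ᵥ (fun i => (L i : ℝ) * v .rho + ∑ j, v (.s i j))) ∧
      (∀ i, InUnarySimplex (v .rho) (fun j => v (.s i j))) ∧
      (∀ k j, v (.z k j) = v (.s k j) + ∑ i, v (.Z k i j)) ∧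
      (∀ k i j, i ≠ k → ∀ τ : ℕ, τ ≤ U i - L i →
        v (.Z k i j) ≤ f i (L i + τ) * v (.s k j) +
          ∑ t : Fin (U i - L i), if τ ≤ (t : ℕ) then levelInc L f i t * v (.s i t) else 0) ∧
      (∀ k i j, i ≠ k → ∀ τ : ℕ, τ ≤ U i - L i →
        f i (L i) * v .rho +
          (∑ t : Fin (U i - L i), if (t : ℕ) < τ then levelInc L f i t * v (.s i t) else 0) +
          f i (L i + τ) * v (.s k j) - f i (L i + τ) * v .rho ≤ v (.Z k i j)) ∧
      (∀ k j, v (.Z k k j) = f k (L k + j + 1) * v (.s k j) +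
        ∑ t : Fin (U k - L k), if j < t then levelInc L f k t * v (.s k t) else 0)} :=
    Set.ext fun v => ⟨fun ⟨h1, h2, h3, h4, h5, h6, h7, h8, h9, h10, h11⟩ =>
      ⟨h1, h2, h3, h4, h5, h6, h7, h8, h9, h10, h11⟩,
      fun ⟨h1, h2, h3, h4, h5, h6, h7, h8, h9, h10, h11⟩ =>
      ⟨h1, h2, h3, h4, h5, h6, h7, h8, h9, h10, h11⟩⟩
  have co (q : InvVar L U) : IsAffineFun (fun v : InvVar L U → ℝ => v q) := .coord q
  rw [key]
  refine .setOf_and (.setOf_forall fun t => .setOf_le (.const _)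
    (.mulVec A (fun i => co _) t)) <| .setOf_and (.setOf_forall fun i =>
    .setOf_eq (co _) (.add (.const _) (.sum fun j => co _))) <|
    .setOf_and (.setOf_forall fun i => .setOf_unarySimplex (.const 1) fun j => co _) <|
    .setOf_and (.setOf_eq (.add (co _) (.sum fun _ => co _)) (.const 1)) <|
    .setOf_and (.setOf_forall fun k => .setOf_eq (co _)
      (.add (.const_mul _ (co _)) (.sum fun _ => .const_mul _ (co _)))) <|
    .setOf_and (.setOf_forall fun t => .setOf_le (.const_mul _ (co _))
      (.mulVec A (fun i => .add (.const_mul _ (co _)) (.sum fun _ => co _)) t)) <|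
    .setOf_and (.setOf_forall fun i => .setOf_unarySimplex (co _) fun j => co _) <|
    .setOf_and (.setOf_forall fun k => .setOf_forall fun j => .setOf_eq (co _)
      (.add (co _) (.sum fun _ => co _))) <|
    .setOf_and (.setOf_forall fun k => .setOf_forall fun i => .setOf_forall fun j =>
      .setOf_imp fun _ => .setOf_forall_le fun τ => .setOf_le (co _)
        (.add (.const_mul _ (co _)) (.sum fun t => .ite_zero _ (.const_mul _ (co _))))) <|
    .setOf_and (.setOf_forall fun k => .setOf_forall fun i => .setOf_forall fun j =>
      .setOf_imp fun _ => .setOf_forall_le fun τ => .setOf_le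
        (.sub (.add (.add (.const_mul _ (co _))
          (.sum fun t => .ite_zero _ (.const_mul _ (co _)))) (.const_mul _ (co _)))
          (.const_mul _ (co _))) (co _)) <|
    .setOf_forall fun k => .setOf_forall fun j => .setOf_eq (co _)
      (.add (.const_mul _ (co _)) (.sum fun t => .ite_zero _ (.const_mul _ (co _))))

/-! ### Telescoping sums -/

theorem sum_fin_ite_lt_sub (g : ℕ → ℝ) {d p : ℕ} (hp : p ≤ d) :
    ∑ t : Fin d, (if (t : ℕ) < p then g (t + 1) - g t else 0) = g p - g 0 := by
  rw [Fin.sum_univ_eq_sum_range (fun t => if t < p then g (t + 1) - g t else 0) d,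
    ← Finset.sum_range_sub g p, ← Finset.sum_filter]
  congr 1
  ext t
  simp only [Finset.mem_filter, Finset.mem_range]
  omega

theorem sum_fin_ite_lt_one {d p : ℕ} (hp : p ≤ d) :
    ∑ t : Fin d, (if (t : ℕ) < p then (1 : ℝ) else 0) = p := by
  simpa using sum_fin_ite_lt_sub (fun t => (t : ℝ)) hp

section

variable {n : ℕ} (L : Fin n → ℕ) (f : Fin n → ℕ → ℝ) (i : Fin n)

/-- Telescoping: a unary code of level `p`, scaled by `c`, turns the linear expression for `μ_i`
back into an attraction value. -/
theorem sum_levelInc_lt {d p : ℕ} (c : ℝ) (hp : p ≤ d) :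
    ∑ t : Fin d, levelInc L f i t * (if (t : ℕ) < p then c else 0) =
      (f i (L i + p) - f i (L i)) * c := by
  have := sum_fin_ite_lt_sub (fun t => f i (L i + t)) hp
  simp only [add_zero] at this
  rw [← this, Finset.sum_mul]
  refine Finset.sum_congr rfl fun t _ => ?_
  simp only [levelInc, add_assoc]
  split_ifs <;> simp

theorem sum_levelInc_lt_lt {d p τ : ℕ} (c : ℝ) (hp : p ≤ d) :
    (∑ t : Fin d, if (t : ℕ) < τ then levelInc L f i t * (if (t : ℕ) < p then c else 0) else 0) =
      (f i (L i + min τ p) - f i (L i)) * c := by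
  rw [← sum_levelInc_lt L f i c ((min_le_right τ p).trans hp)]
  refine Finset.sum_congr rfl fun t _ => ?_
  simp only [lt_min_iff]
  by_cases h1 : (t : ℕ) < τ <;> by_cases h2 : (t : ℕ) < p <;> simp [h1, h2]

/-- A difference of two prefix sums, up to `max τ p` and up to `τ`. -/
theorem sum_levelInc_ge_lt {d p τ : ℕ} (c : ℝ) (hp : p ≤ d) (hτ : τ ≤ d) :
    (∑ t : Fin d, if τ ≤ (t : ℕ) then levelInc L f i t * (if (t : ℕ) < p then c else 0) else 0) =
      (f i (L i + max τ p) - f i (L i + τ)) * c := by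
  have h1 := sum_levelInc_lt L f i c (max_le hτ hp)
  have h2 := sum_levelInc_lt L f i c hτ
  have : (f i (L i + max τ p) - f i (L i + τ)) * c =
    (f i (L i + max τ p) - f i (L i)) * c - (f i (L i + τ) - f i (L i)) * c := by ring
  rw [this, ← h1, ← h2, ← Finset.sum_sub_distrib]
  refine Finset.sum_congr rfl fun t _ => ?_
  simp only [lt_max_iff]
  by_cases h1 : (t : ℕ) < τ
  · simp [h1]
  · by_cases h2 : (t : ℕ) < p <;> simp [h1, h2, not_lt.1 h1]

end

/-! ### Inventory vectors give points of the formulation -/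

/-- The point of the formulation representing the inventory vector `x`. -/
noncomputable def invLift {n : ℕ} (L U : Fin n → ℕ) (f : Fin n → ℕ → ℝ) (x : Fin n → ℕ) :
    InvVar L U → ℝ
  | .x i => x i
  | .rho => (1 + ∑ j, f j (x j))⁻¹
  | .mu i => choiceProb f x i
  | .s i j => if (j : ℕ) < x i - L i then (1 + ∑ j, f j (x j))⁻¹ else 0
  | .z i j => if (j : ℕ) < x i - L i then 1 else 0
  | .Z k i j => f i (x i) * if (j : ℕ) < x k - L k then (1 + ∑ j, f j (x j))⁻¹ else 0

theorem inUnarySimplex_ite {d p : ℕ} {c : ℝ} (hc : 0 ≤ c) :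
    InUnarySimplex c (fun j : Fin d => if (j : ℕ) < p then c else 0) := by
  refine ⟨hc, fun j j' h => ?_, fun j => ?_⟩
  · have : (j : ℕ) ≤ j' := h
    dsimp only
    split_ifs <;> first | omega | exact hc | exact le_rfl
  · dsimp only
    split_ifs
    · exact ⟨hc, le_rfl⟩
    · exact ⟨le_rfl, hc⟩

section

variable {n m : ℕ} {L U : Fin n → ℕ} {A : Matrix (Fin m) (Fin n) ℝ} {b : Fin m → ℝ}
  {f : Fin n → ℕ → ℝ}

/-- After telescoping, the bounds on `Z` compare `f_i` at `x_i` or `L_i + τ` with its value at the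
larger (upper bound) or smaller (lower bound) of these two levels. -/
theorem invLift_mem_invIP (hf : ∀ i, MonotoneOn (f i) (Set.Icc (L i) (U i))) {x : Fin n → ℕ}
    (hx : x ∈ invFeasible L U A b) (hpos : 0 < 1 + ∑ i, f i (x i)) :
    invLift L U f x ∈ invIP L U A b f := by
  obtain ⟨hb, hA⟩ := hx
  set c : ℝ := (1 + ∑ j, f j (x j))⁻¹ with hc
  have hc0 : 0 < c := inv_pos.2 hpos
  have hcD : c + ∑ i, f i (x i) * c = 1 := by
    rw [← Finset.sum_mul, hc]
    field_simp
  have hp : ∀ i, x i - L i ≤ U i - L i := fun i => Nat.sub_le_sub_right (hb i).2 _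
  have hLx : ∀ i, L i + (x i - L i) = x i := fun i => Nat.add_sub_of_le (hb i).1
  have hLxR : ∀ i, (L i : ℝ) + ((x i - L i : ℕ) : ℝ) = x i := fun i => by
    exact_mod_cast hLx i
  have hsum : ∀ i, ∑ t : Fin (U i - L i), (if (t : ℕ) < x i - L i then c else 0) =
      ((x i - L i : ℕ) : ℝ) * c := fun i => by
    rw [← sum_fin_ite_lt_one (hp i), Finset.sum_mul]
    simp
  have hmono : ∀ i a a', L i ≤ a → a ≤ a' → a' ≤ U i → f i a ≤ f i a' :=
    fun i a a' h1 h2 h3 => hf i ⟨h1, h2.trans h3⟩ ⟨h1.trans h2, h3⟩ h2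
  refine ⟨⟨hA, ?_, ?_, ?_, ?_, ?_, ?_, ?_, ?_, ?_, ?_⟩, ?_⟩
  · intro i
    simp only [invLift]
    rw [sum_fin_ite_lt_one (hp i), hLxR]
  · exact fun i => inUnarySimplex_ite zero_le_one
  · simp only [invLift, choiceProb, div_eq_mul_inv]
    exact hcD
  · intro k
    simp only [invLift, choiceProb, div_eq_mul_inv]
    rw [sum_levelInc_lt L f k _ (hp k), hLx]
    ring
  · have : (fun i => (L i : ℝ) * invLift L U f x .rho + ∑ j, invLift L U f x (.s i j)) =
        c • (fun i => (x i : ℝ)) := by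
      funext i
      simp only [invLift, Pi.smul_apply, smul_eq_mul]
      rw [← hc, hsum, ← hLxR]
      ring
    rw [this, Matrix.mulVec_smul]
    intro t
    have := mul_le_mul_of_nonneg_left (hA t) hc0.le
    simp only [invLift, Pi.smul_apply, smul_eq_mul]
    rw [mul_comm]
    exact this
  · exact fun i => inUnarySimplex_ite hc0.le
  · intro k j
    simp only [invLift]
    rw [← hc]
    split_ifs
    · exact hcD.symm
    · simp
  · intro k i j _ τ hτ
    simp only [invLift]
    rw [← hc, sum_levelInc_ge_lt L f i c (hp i) hτ]
    have h1 : f i (L i + τ) ≤ f i (L i + max τ (x i - L i)) :=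
      hmono _ _ _ (by omega) (by omega) (by have := hp i; have := hb i; omega)
    have h2 : f i (x i) ≤ f i (L i + max τ (x i - L i)) :=
      hmono _ _ _ (hb i).1 (by omega) (by have := hp i; have := hb i; omega)
    split_ifs
    · nlinarith
    · nlinarith
  · intro k i j _ τ hτ
    simp only [invLift]
    rw [← hc, sum_levelInc_lt_lt L f i c (hp i)]
    have h1 : f i (L i + min τ (x i - L i)) ≤ f i (L i + τ) :=
      hmono _ _ _ (by omega) (by omega) (by have := hp i; have := hb i; omega)
    have h2 : f i (L i + min τ (x i - L i)) ≤ f i (x i) :=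
      hmono _ _ _ (by omega) (by have := hb i; omega) (by have := hp i; have := hb i; omega)
    split_ifs
    · nlinarith
    · nlinarith
  · intro k j
    simp only [invLift]
    -- The index `j` stands for level `j + 1`, so the condition `j < t` is the case `τ = j + 1`.
    have := sum_levelInc_ge_lt L f k c (hp k) (Nat.succ_le_of_lt j.2)
    simp only [Nat.succ_le_iff, Fin.val_fin_lt] at this
    rw [← hc, this]
    split_ifs with h
    · rw [max_eq_right (Nat.succ_le_of_lt h), hLx, Nat.succ_eq_add_one, add_assoc]
      ring
    · rw [max_eq_left (by omega)]
      ring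
  · rintro _ ⟨i, j, rfl⟩
    simp only [invLift]
    split_ifs <;> simp

/-! ### Points of the formulation represent inventory vectors -/

/-- The cut `p` is the position of the first zero, or `d` if there is none. -/
theorem exists_eq_ite_of_antitone_binary {d : ℕ} {y : Fin d → ℝ} (hy : Antitone y)
    (h01 : ∀ j, y j = 0 ∨ y j = 1) :
    ∃ p ≤ d, ∀ j, y j = if (j : ℕ) < p then 1 else 0 := by
  classical
  by_cases h : ∃ t, ∃ ht : t < d, y ⟨t, ht⟩ = 0
  · obtain ⟨hlt, h0⟩ := Nat.find_spec h
    refine ⟨Nat.find h, hlt.le, fun j => ?_⟩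
    split_ifs with hj
    · exact (h01 j).resolve_left fun hz => Nat.find_min h hj ⟨j.2, hz⟩
    · refine (h01 j).resolve_right fun h1 => ?_
      have : y j ≤ y ⟨Nat.find h, hlt⟩ := hy (not_lt.1 hj)
      linarith
  · push Not at h
    exact ⟨d, le_rfl, fun j => by
      simpa using (h01 j).resolve_left (h j j.2)⟩

theorem levelInc_nonneg (hf : ∀ i, MonotoneOn (f i) (Set.Icc (L i) (U i))) (i : Fin n)
    (t : Fin (U i - L i)) : 0 ≤ levelInc L f i t := by
  have := t.2
  exact sub_nonneg.2 (hf i ⟨by omega, by omega⟩ ⟨by omega, by omega⟩ (by omega))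

/-- The LP relaxation bounds `z` by McCormick-type inequalities in `s` and `ρ`. -/
theorem InvLPFeasible.z_bounds (hf : ∀ i, MonotoneOn (f i) (Set.Icc (L i) (U i)))
    {w : InvVar L U → ℝ} (hw : InvLPFeasible L U A b f w) (k : Fin n) (j : Fin (U k - L k)) :
    (1 + ∑ i, f i (L i)) * w (.s k j) ≤ w (.z k j) ∧
      w (.z k j) ≤ 1 + (1 + ∑ i, f i (L i)) * (w (.s k j) - w .rho) := by
  obtain ⟨-, hanti, hs⟩ := hw.s_mem k
  have hinc := levelInc_nonneg (L := L) (U := U) (f := f) hf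
  have hlow : ∀ i, f i (L i) * w (.s k j) ≤ w (.Z k i j) := by
    intro i
    by_cases hik : i = k
    · subst hik
      rw [hw.Z_self]
      have h1 : f i (L i) ≤ f i (L i + j + 1) := by
        have := j.2
        exact hf i ⟨le_rfl, by omega⟩ ⟨by omega, by omega⟩ (by omega)
      have h2 := mul_le_mul_of_nonneg_right h1 (hs j).1
      have h3 : 0 ≤ ∑ t : Fin (U i - L i),
          if j < t then levelInc L f i t * w (.s i t) else 0 :=
        Finset.sum_nonneg fun t _ => by
          split_ifs
          · exact mul_nonneg (hinc i t) (hs t).1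
          · exact le_rfl
      linarith
    · have := hw.Z_ge k i j hik 0 (Nat.zero_le _)
      simp at this
      linarith
  have hup : ∀ i, w (.Z k i j) ≤ w (.mu i) + f i (L i) * (w (.s k j) - w .rho) := by
    intro i
    by_cases hik : i = k
    · subst hik
      rw [hw.Z_self, hw.mu_eq]
      have h1 := sum_levelInc_lt L f i (w (.s i j)) (Nat.succ_le_of_lt j.2)
      -- Since `s_i` is antitone, `s_{ij}` may be replaced by the larger `s_{it}` in the increments
      -- with `t ≤ j`; this bounds the diagonal variable by `μ_i`.
      have h2 : (∑ t : Fin (U i - L i),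
            levelInc L f i t * (if (t : ℕ) < (j : ℕ).succ then w (.s i j) else 0)) +
          (∑ t : Fin (U i - L i), if j < t then levelInc L f i t * w (.s i t) else 0) ≤
          ∑ t : Fin (U i - L i), levelInc L f i t * w (.s i t) := by
        rw [← Finset.sum_add_distrib]
        refine Finset.sum_le_sum fun t _ => ?_
        by_cases h : j < t
        · have : ¬ (t : ℕ) < (j : ℕ).succ := by
            have : (j : ℕ) < t := h
            omega
          simp [h, this]
        · have h' : (t : ℕ) < (j : ℕ).succ := Nat.lt_succ_of_le (not_lt.1 h)
          simp only [h, h', if_true, if_false, add_zero]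
          exact mul_le_mul_of_nonneg_left (hanti (not_lt.1 h)) (hinc i t)
      rw [h1, Nat.succ_eq_add_one, ← add_assoc] at h2
      linarith
    · have := hw.Z_le k i j hik 0 (Nat.zero_le _)
      simp only [zero_le, if_true, add_zero] at this
      rw [hw.mu_eq]
      linarith
  rw [hw.z_eq]
  have h1 := Finset.sum_le_sum fun i (_ : i ∈ Finset.univ) => hlow i
  have h2 := Finset.sum_le_sum fun i (_ : i ∈ Finset.univ) => hup i
  rw [← Finset.sum_mul] at h1
  rw [Finset.sum_add_distrib, ← Finset.sum_mul] at h2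
  have := hw.total
  constructor <;> linarith

/-- A point of the formulation is determined, up to redundant variables, by an inventory
vector. -/
theorem exists_invFeasible_of_mem_invIP (hf : ∀ i, MonotoneOn (f i) (Set.Icc (L i) (U i)))
    (hpos : ∀ x : Fin n → ℕ, (∀ i, L i ≤ x i ∧ x i ≤ U i) → 0 < 1 + ∑ i, f i (x i))
    (hLU : ∀ i, L i ≤ U i) {w : InvVar L U → ℝ} (hw : w ∈ invIP L U A b f) :
    ∃ x ∈ invFeasible L U A b, (∀ i, w (.x i) = (x i : ℝ)) ∧
      ∀ i, w (.mu i) = choiceProb f x i := by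
  obtain ⟨hw, hbin⟩ := hw
  have hw : InvLPFeasible L U A b f w := hw
  choose p hp hz using fun i => exists_eq_ite_of_antitone_binary (hw.z_mem i).2.1
    fun j => hbin _ ⟨i, j, rfl⟩
  have hx : ∀ i, w (.x i) = ((L i + p i : ℕ) : ℝ) := fun i => by
    rw [hw.x_eq, Finset.sum_congr rfl fun j _ => hz i j, sum_fin_ite_lt_one (hp i)]
    push_cast
    rfl
  have hbox : ∀ i, L i ≤ L i + p i ∧ L i + p i ≤ U i := fun i => by
    have := hp i; have := hLU i; omega
  have hD := hpos (fun i => L i + p i) hbox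
  have hL := hpos L fun i => ⟨le_rfl, hLU i⟩
  -- By positivity of `1 + ∑ f_i(L_i)`, the upper bound on `z` at `z = 1` gives `s ≥ ρ`, and the
  -- lower bound at `z = 0` gives `s ≤ 0`.
  have hs : ∀ i j, w (.s i j) = if (j : ℕ) < p i then w .rho else 0 := fun i j => by
    obtain ⟨h1, h2⟩ := hw.z_bounds hf i j
    have hsj := (hw.s_mem i).2.2 j
    rw [hz i j] at h1 h2
    split_ifs at h1 h2 ⊢
    · refine le_antisymm hsj.2 ?_
      by_contra! hlt
      nlinarith
    · refine le_antisymm ?_ hsj.1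
      by_contra! hlt
      nlinarith
  have hmu : ∀ i, w (.mu i) = f i (L i + p i) * w .rho := fun i => by
    rw [hw.mu_eq, Finset.sum_congr rfl fun j _ => by rw [hs i j],
      sum_levelInc_lt L f i _ (hp i)]
    ring
  have hrho : w .rho * (1 + ∑ i, f i (L i + p i)) = 1 := by
    have := hw.total
    simp only [hmu, ← Finset.sum_mul] at this
    linarith
  refine ⟨fun i => L i + p i, ⟨hbox, ?_⟩, hx, fun i => ?_⟩
  · have := hw.poly
    simpa only [hx] using this
  · rw [hmu, choiceProb, eq_div_iff hD.ne']
    linear_combination f i (L i + p i) * hrho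

/-! ### Exactness of the formulation and transfer of optimal solutions -/

theorem invObj_eq_expectedSales {w : InvVar L U → ℝ} {x : Fin n → ℕ} (r : Fin n → ℝ)
    (h : ∀ i, w (.mu i) = choiceProb f x i) : invObj L U r w = expectedSales r f x := by
  simp only [invObj, expectedSales, h]

theorem isMIPFormulation_invLP (hf : ∀ i, MonotoneOn (f i) (Set.Icc (L i) (U i)))
    (hpos : ∀ x : Fin n → ℕ, (∀ i, L i ≤ x i ∧ x i ≤ U i) → 0 < 1 + ∑ i, f i (x i))
    (hLU : ∀ i, L i ≤ U i) :
    IsMIPFormulation (invLP L U A b f) (invBinary L U) (Sum.elim InvVar.x InvVar.mu)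
      (invGraph L U A b f) := by
  refine ⟨isPolyhedron_invLP .., Set.ext fun u => ⟨?_, ?_⟩⟩
  · rintro ⟨w, hw, rfl⟩
    exact exists_invFeasible_of_mem_invIP hf hpos hLU hw
  · rintro ⟨x, hx, h1, h2⟩
    refine ⟨invLift L U f x, invLift_mem_invIP hf hx (hpos x hx.1), funext ?_⟩
    rintro (i | i)
    · exact (h1 i).symm
    · exact (h2 i).symm

/-- If the values of `Q ⊇ invIP` are dominated by expected sales, then maximizing over `Q`
solves the inventory problem. -/
theorem isOptimal_expectedSales_iff (hf : ∀ i, MonotoneOn (f i) (Set.Icc (L i) (U i)))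
    (hpos : ∀ x : Fin n → ℕ, (∀ i, L i ≤ x i ∧ x i ≤ U i) → 0 < 1 + ∑ i, f i (x i))
    (hLU : ∀ i, L i ≤ U i) (r : Fin n → ℝ) {Q : Set (InvVar L U → ℝ)}
    (hQ : invIP L U A b f ⊆ Q)
    (hdom : ∀ w ∈ Q, ∃ x ∈ invFeasible L U A b, invObj L U r w ≤ expectedSales r f x)
    (x : Fin n → ℕ) :
    IsOptimal (invFeasible L U A b) (expectedSales r f) x ↔
      ∃ w ∈ invIP L U A b f, IsOptimal Q (invObj L U r) w ∧ ∀ i, w (.x i) = (x i : ℝ) := by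
  constructor
  · rintro ⟨hx, hmax⟩
    have hw := invLift_mem_invIP hf hx (hpos x hx.1)
    refine ⟨_, hw, ⟨hQ hw, fun w' hw' => ?_⟩, fun i => rfl⟩
    obtain ⟨x', hx', hle⟩ := hdom w' hw'
    exact hle.trans (hmax hx')
  · rintro ⟨w, hw, ⟨-, hmax⟩, hwx⟩
    obtain ⟨x', hx', h1, h2⟩ := exists_invFeasible_of_mem_invIP hf hpos hLU hw
    obtain rfl : x' = x := funext fun i => by exact_mod_cast (h1 i).symm.trans (hwx i)
    refine ⟨hx', fun y hy => ?_⟩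
    have := hmax (hQ (invLift_mem_invIP hf hy (hpos y hy.1)))
    simp only [Set.mem_ofPred_eq] at this ⊢
    rwa [invObj_eq_expectedSales r h2, invObj_eq_expectedSales r fun i => rfl] at this

end

/-! ### Rounding for a cap on the total inventory -/

/-- Greedy filling of antitone rows: the filled entries are separated from the others by a
threshold, which vanishes unless the capacity is exhausted. -/
theorem exists_greedy {n : ℕ} (d : Fin n → ℕ) (c : Fin n → ℕ → ℝ)
    (hc0 : ∀ i t, t < d i → 0 ≤ c i t)
    (hanti : ∀ i t t', t ≤ t' → t' < d i → c i t' ≤ c i t) (K : ℕ) :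
    ∃ (x : Fin n → ℕ) (θ : ℝ), 0 ≤ θ ∧ (∀ i, x i ≤ d i) ∧ ∑ i, x i ≤ K ∧
      (θ = 0 ∨ ∑ i, x i = K) ∧ (∀ i t, t < x i → θ ≤ c i t) ∧
      ∀ i t, x i ≤ t → t < d i → c i t ≤ θ := by
  induction K with
  | zero =>
    -- With no capacity, any common upper bound of the first entries of nonempty rows is a valid
    -- threshold.
    refine ⟨0, ∑ i, |c i 0|, Finset.sum_nonneg fun i _ => abs_nonneg _, fun i => Nat.zero_le _,
      by simp, by simp, fun i t h => absurd h (Nat.not_lt_zero t), fun i t _ h => ?_⟩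
    exact (hanti i 0 t (Nat.zero_le t) h).trans <| (le_abs_self _).trans <|
      Finset.single_le_sum (f := fun i => |c i 0|) (fun i _ => abs_nonneg _) (Finset.mem_univ i)
  | succ K ih =>
    obtain ⟨x, θ, hθ, hxd, hxK, hor, hin, hout⟩ := ih
    by_cases hlt : ∑ i, x i < K
    · exact ⟨x, θ, hθ, hxd, by omega, .inl (hor.resolve_right hlt.ne), hin, hout⟩
    by_cases hne : ∃ i, x i < d i
    -- The largest next available entry is filled and becomes the new threshold; it lies below the
    -- old one, so earlier entries stay above it.
    · obtain ⟨i₀, hi₀, hmax⟩ := (Finset.univ.filter fun i => x i < d i).exists_max_image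
        (fun i => c i (x i)) (by simpa [Finset.filter_nonempty_iff] using hne)
      simp only [Finset.mem_filter, Finset.mem_univ, true_and] at hi₀ hmax
      have hsum : ∑ i, Function.update x i₀ (x i₀ + 1) i = ∑ i, x i + 1 := by
        rw [Finset.sum_update_of_mem (Finset.mem_univ i₀),
          ← Finset.add_sum_erase _ _ (Finset.mem_univ i₀), Finset.sdiff_singleton_eq_erase]
        omega
      refine ⟨Function.update x i₀ (x i₀ + 1), c i₀ (x i₀), hc0 _ _ hi₀, fun i => ?_,
        by omega, .inr (by omega), fun i t ht => ?_, fun i t ht htd => ?_⟩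
      · by_cases h : i = i₀
        · subst h
          simpa using hi₀
        · simpa [h] using hxd i
      · by_cases h : i = i₀
        · subst h
          exact hanti i t (x i) (by simpa [Nat.lt_succ_iff] using ht) hi₀
        · exact (hout i₀ _ le_rfl hi₀).trans (hin i t (by simpa [h] using ht))
      · have hxt : x i ≤ t := by
          by_cases h : i = i₀
          · subst h
            simp at ht
            omega
          · simpa [h] using ht
        exact (hanti i (x i) t hxt htd).trans (hmax i (hxt.trans_lt htd))
    · push Not at hne
      exact ⟨x, 0, le_rfl, hxd, by omega, .inl rfl, fun i t h => hc0 i t (h.trans_le (hxd i)),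
        fun i t h h' => absurd (h'.trans_le (hne i)) (not_lt.2 h)⟩

/-- Integrality of the fractional knapsack with unit weights and antitone nonnegative rows. -/
theorem exists_integral_knapsack {n : ℕ} (d : Fin n → ℕ) (c : Fin n → ℕ → ℝ)
    (hc0 : ∀ i t, t < d i → 0 ≤ c i t)
    (hanti : ∀ i t t', t ≤ t' → t' < d i → c i t' ≤ c i t) (y : ∀ i, Fin (d i) → ℝ)
    (hy : ∀ i j, 0 ≤ y i j ∧ y i j ≤ 1) (K : ℕ) (hK : ∑ i, ∑ j, y i j ≤ K) :
    ∃ x : Fin n → ℕ, (∀ i, x i ≤ d i) ∧ ∑ i, x i ≤ K ∧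
      ∑ i, ∑ j : Fin (d i), c i j * y i j ≤
        ∑ i, ∑ j : Fin (d i), c i j * if (j : ℕ) < x i then 1 else 0 := by
  obtain ⟨x, θ, hθ, hxd, hxK, hor, hin, hout⟩ := exists_greedy d c hc0 hanti K
  refine ⟨x, hxd, hxK, ?_⟩
  -- Entrywise, `c - θ` and `y` minus the indicator have opposite signs. The `θ`-terms sum to at
  -- most zero, as `θ = 0` or `x` exhausts the capacity.
  have h1 : ∑ i, ∑ j : Fin (d i), c i j * y i j ≤
      ∑ i, ∑ j : Fin (d i), (c i j * (if (j : ℕ) < x i then 1 else 0) +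
        θ * (y i j - if (j : ℕ) < x i then 1 else 0)) := by
    refine Finset.sum_le_sum fun i _ => Finset.sum_le_sum fun j _ => ?_
    obtain ⟨hy0, hy1⟩ := hy i j
    split_ifs with h
    · nlinarith [hin i j h]
    · nlinarith [hout i j (not_lt.1 h) j.2]
  simp only [Finset.sum_add_distrib, ← Finset.mul_sum, Finset.sum_sub_distrib,
    fun i => sum_fin_ite_lt_one (hxd i)] at h1
  rcases hor with rfl | hK'
  · simpa using h1
  · have : (∑ i, (x i : ℝ)) = K := by exact_mod_cast hK'
    rw [this] at h1
    nlinarith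

/-! ### Dominating LP points by inventory vectors -/

section

variable {n m : ℕ} {L U : Fin n → ℕ} {A : Matrix (Fin m) (Fin n) ℝ} {b : Fin m → ℝ}
  {f : Fin n → ℕ → ℝ}

/-- If `ρ = 0`, then every `s_{ij}` and hence every `μ_i` vanishes, contradicting `ρ + ∑ μ_i = 1`.
-/
theorem InvLPFeasible.rho_pos {w : InvVar L U → ℝ} (hw : InvLPFeasible L U A b f w) :
    0 < w .rho := by
  have h0 : 0 ≤ w .rho := by
    by_cases hn : n = 0
    · subst hn
      have := hw.total
      simp at this
      linarith
    · exact (hw.s_mem ⟨0, Nat.pos_of_ne_zero hn⟩).1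
  refine h0.lt_of_ne fun h => ?_
  have hs : ∀ i j, w (.s i j) = 0 := fun i j => by
    have := (hw.s_mem i).2.2 j
    rw [← h] at this
    exact le_antisymm this.2 this.1
  have := hw.total
  simp [hw.mu_eq, hs, ← h] at this

/-- Under a cap on the total inventory and concave attractions, every point of the LP relaxation
is dominated by an inventory vector. -/
theorem InvLPFeasible.exists_le_expectedSales
    (hf : ∀ i, MonotoneOn (f i) (Set.Icc (L i) (U i)))
    (hpos : ∀ x : Fin n → ℕ, (∀ i, L i ≤ x i ∧ x i ≤ U i) → 0 < 1 + ∑ i, f i (x i))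
    (hLU : ∀ i, L i ≤ U i)
    (hinc : ∀ i t t', t ≤ t' → t' < U i - L i → levelInc L f i t' ≤ levelInc L f i t) {cap : ℤ}
    (hcap : {y : Fin n → ℝ | (∀ i, (L i : ℝ) ≤ y i ∧ y i ≤ (U i : ℝ)) ∧ b ≤ A *ᵥ y} =
      {y : Fin n → ℝ | (∀ i, (L i : ℝ) ≤ y i ∧ y i ≤ (U i : ℝ)) ∧ ∑ i, y i ≤ (cap : ℝ)})
    (r : Fin n → ℝ) {w : InvVar L U → ℝ} (hw : InvLPFeasible L U A b f w) :
    ∃ x ∈ invFeasible L U A b, invObj L U r w ≤ expectedSales r f x := by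
  have hρ := hw.rho_pos
  set ρ := w .rho with hρ_def
  have hd : ∀ i, ((U i - L i : ℕ) : ℝ) = U i - L i := fun i => Nat.cast_sub (hLU i)
  have hy : ∀ i j, 0 ≤ w (.s i j) / ρ ∧ w (.s i j) / ρ ≤ 1 := fun i j =>
    ⟨div_nonneg ((hw.s_mem i).2.2 j).1 hρ.le, div_le_one_of_le₀ ((hw.s_mem i).2.2 j).2 hρ.le⟩
  have hysum : ∀ i, 0 ≤ ∑ j, w (.s i j) / ρ ∧ ∑ j, w (.s i j) / ρ ≤ (U i : ℝ) - L i := by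
    intro i
    refine ⟨Finset.sum_nonneg fun j _ => (hy i j).1, ?_⟩
    refine (Finset.sum_le_sum fun j _ => (hy i j).2).trans ?_
    simp [hd]
  have hycap : ∑ i, ((L i : ℝ) + ∑ j, w (.s i j) / ρ) ≤ cap := by
    refine ((Set.ext_iff.1 hcap fun i => (L i : ℝ) + ∑ j, w (.s i j) / ρ).1
      ⟨fun i => ⟨?_, ?_⟩, ?_⟩).2
    · linarith [(hysum i).1]
    · linarith [(hysum i).2]
    · have : (fun i => (L i : ℝ) + ∑ j, w (.s i j) / ρ) =
          ρ⁻¹ • (fun i => (L i : ℝ) * ρ + ∑ j, w (.s i j)) := by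
        funext i
        simp only [Pi.smul_apply, smul_eq_mul, ← Finset.sum_div]
        field_simp
      rw [this, Matrix.mulVec_smul]
      intro t
      have := mul_le_mul_of_nonneg_left (hw.scaled t) (inv_pos.2 hρ).le
      rw [Pi.smul_apply, smul_eq_mul]
      refine le_trans (le_of_eq ?_) this
      rw [← hρ_def]
      field_simp
  -- `K` is the capacity left above the lower levels; `s/ρ ≥ 0` shows that it is not negative.
  obtain ⟨K, hK⟩ : ∃ K : ℕ, (K : ℤ) = cap - ∑ i, (L i : ℤ) := by
    refine Int.eq_ofNat_of_zero_le ?_ |>.imp fun _ h => h.symm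
    have : (∑ i, (L i : ℝ)) ≤ cap := by
      refine le_trans (Finset.sum_le_sum fun i _ => ?_) hycap
      linarith [(hysum i).1]
    have : (∑ i, (L i : ℤ)) ≤ cap := by exact_mod_cast this
    linarith
  have hKR : (K : ℝ) = cap - ∑ i, (L i : ℝ) := by exact_mod_cast hK
  set lam := invObj L U r w with hlam
  -- Truncating `r_i - λ` at zero makes the knapsack profits nonnegative and antitone in every row.
  -- Rows with `r_i ≤ λ` then have zero profit, so they are reset to `L_i` afterwards, which only
  -- frees capacity.
  have hinc0 := levelInc_nonneg (L := L) (U := U) (f := f) hf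
  obtain ⟨p, hpd, hpK, hp⟩ := exists_integral_knapsack (fun i => U i - L i)
    (fun i t => max (r i - lam) 0 * levelInc L f i t)
    (fun i t ht => mul_nonneg (le_max_right _ _) (hinc0 i ⟨t, ht⟩))
    (fun i t t' h h' => mul_le_mul_of_nonneg_left (hinc i t t' h h') (le_max_right _ _))
    (fun i j => w (.s i j) / ρ) hy K (by
      rw [Finset.sum_add_distrib] at hycap
      linarith)
  set x : Fin n → ℕ := fun i => L i + if lam < r i then p i else 0 with hx
  have hxp : ∀ i, x i ≤ L i + p i := fun i => by
    simp only [hx]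
    split_ifs <;> omega
  have hbox : ∀ i, L i ≤ x i ∧ x i ≤ U i := fun i =>
    ⟨Nat.le_add_right _ _, by have := hxp i; have := hpd i; have := hLU i; omega⟩
  have hxsum : ∑ i, (x i : ℝ) ≤ cap := by
    have h1 : ∑ i, (x i : ℝ) ≤ ∑ i, ((L i : ℝ) + p i) :=
      Finset.sum_le_sum fun i _ => by exact_mod_cast hxp i
    have h2 : ∑ i, (p i : ℝ) ≤ K := by exact_mod_cast hpK
    rw [Finset.sum_add_distrib] at h1
    linarith
  have hxA : b ≤ A *ᵥ (fun i => (x i : ℝ)) :=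
    ((Set.ext_iff.1 hcap fun i => (x i : ℝ)).2
      ⟨fun i => ⟨Nat.cast_le.2 (hbox i).1, Nat.cast_le.2 (hbox i).2⟩, hxsum⟩).2
  refine ⟨x, ⟨hbox, hxA⟩, ?_⟩
  have hrow : ∀ i, ∑ j : Fin (U i - L i), max (r i - lam) 0 * levelInc L f i j *
      (if (j : ℕ) < p i then 1 else 0) = (r i - lam) * (f i (x i) - f i (L i)) := by
    intro i
    simp only [mul_assoc]
    rw [← Finset.mul_sum, sum_levelInc_lt L f i _ (hpd i)]
    simp only [hx]
    split_ifs with h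
    · rw [max_eq_left (by linarith)]
      ring
    · rw [max_eq_right (by linarith)]
      simp
  have hrow' : ∀ i, (r i - lam) * (w (.mu i) / ρ - f i (L i)) ≤
      ∑ j : Fin (U i - L i), max (r i - lam) 0 * levelInc L f i j * (w (.s i j) / ρ) := by
    intro i
    have h1 : w (.mu i) / ρ - f i (L i) =
        ∑ j : Fin (U i - L i), levelInc L f i j * (w (.s i j) / ρ) := by
      simp only [← mul_div_assoc]
      rw [hw.mu_eq, ← Finset.sum_div, ← hρ_def]
      field_simp
      ring
    rw [h1]
    simp only [mul_assoc]
    rw [← Finset.mul_sum]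
    exact mul_le_mul_of_nonneg_right (le_max_left _ _)
      (Finset.sum_nonneg fun j _ => mul_nonneg (hinc0 i j) (hy i j).1)
  have h1 := (Finset.sum_le_sum fun i (_ : i ∈ Finset.univ) => hrow' i).trans hp
  simp only [hrow, mul_sub, Finset.sum_sub_distrib] at h1
  -- Combines `∑ r_i μ_i = λ` with `∑ μ_i = 1 - ρ`.
  have h2 : ∑ i, (r i - lam) * (w (.mu i) / ρ) = lam := by
    simp only [← mul_div_assoc, sub_mul]
    rw [← Finset.sum_div, Finset.sum_sub_distrib, ← Finset.mul_sum,
      show ∑ i, w (.mu i) = 1 - ρ by linarith [hw.total],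
      show ∑ i, r i * w (.mu i) = lam from rfl]
    field_simp
    ring
  have hD := hpos x hbox
  simp only [expectedSales, choiceProb, ← mul_div_assoc]
  rw [← Finset.sum_div, le_div_iff₀ hD]
  have h3 : ∑ i, (r i - lam) * f i (x i) = ∑ i, r i * f i (x i) - lam * ∑ i, f i (x i) := by
    simp only [sub_mul, Finset.sum_sub_distrib, ← Finset.mul_sum]
  linarith

theorem exists_isOptimal_invFeasible (r : Fin n → ℝ) (h : (invFeasible L U A b).Nonempty) :
    ∃ x, IsOptimal (invFeasible L U A b) (expectedSales r f) x := by
  have hfin : (invFeasible L U A b).Finite := by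
    refine (Set.Finite.pi' fun i => Set.finite_Icc (L i) (U i)).subset fun x hx i => hx.1 i
  obtain ⟨x, hx, hmax⟩ := hfin.exists_maximalFor (expectedSales r f) _ h
  exact ⟨x, hx, fun y hy => (le_total _ _).elim id fun h => hmax hy h⟩

end

/-! ### Concave attractions -/

/-- Both `a + h` and `c` are convex combinations of `a` and `c + h`, with the weights swapped; the
two concavity inequalities are added. -/
theorem ConcaveOn.sub_le_sub_of_le {s : Set ℝ} {g : ℝ → ℝ} (hg : ConcaveOn ℝ s g) {a c h : ℝ}
    (hh : 0 < h) (hac : a ≤ c) (ha : a ∈ s) (hc : c + h ∈ s) :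
    g (c + h) - g c ≤ g (a + h) - g a := by
  have hp : 0 < c - a + h := by linarith
  have h1 := hg.2 ha hc (div_nonneg (sub_nonneg.2 hac) hp.le) (div_nonneg hh.le hp.le)
    (by field_simp)
  have h2 := hg.2 ha hc (div_nonneg hh.le hp.le) (div_nonneg (sub_nonneg.2 hac) hp.le)
    (by field_simp; ring)
  simp only [smul_eq_mul] at h1 h2
  rw [show (c - a) / (c - a + h) * a + h / (c - a + h) * (c + h) = a + h by field_simp; ring] at h1
  rw [show h / (c - a + h) * a + (c - a) / (c - a + h) * (c + h) = c by field_simp; ring] at h2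
  have e : h / (c - a + h) = 1 - (c - a) / (c - a + h) := by field_simp; ring
  rw [e] at h1 h2
  linarith

/-- A concave function that drops once stays below the descending secant line, which becomes
negative on an unbounded ray. -/
theorem ConcaveOn.monotoneOn_of_nonneg {g : ℝ → ℝ} (hg : ConcaveOn ℝ (Set.Ici 0) g)
    (h0 : ∀ t, 0 ≤ g t) : MonotoneOn g (Set.Ici 0) := by
  intro a ha c hc hac
  by_contra! hlt
  have hac : a < c := hac.lt_of_ne fun h => by simp [h] at hlt
  have hk : 0 < g a - g c := by linarith
  -- The secant through `a` and `c` takes the value `-1` at `z`.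
  obtain ⟨z, hz⟩ : ∃ z, z = c + (c - a) * (g c + 1) / (g a - g c) := ⟨_, rfl⟩
  have hcz : c < z := by
    have : 0 < (c - a) * (g c + 1) / (g a - g c) :=
      div_pos (mul_pos (by linarith) (by linarith [h0 c])) hk
    linarith
  have h := hg.slope_anti_adjacent ha (show z ∈ Set.Ici (0 : ℝ) from hc.out.trans hcz.le) hac hcz
  rw [div_le_div_iff₀ (by linarith) (by linarith)] at h
  have hzc : (g a - g c) * (z - c) = (c - a) * (g c + 1) := by
    rw [hz]
    field_simp
    ring
  nlinarith [h0 z, mul_nonneg (h0 z) (sub_pos.2 hac).le]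

/-! ### General attractions and the capped concave case -/

theorem corollary5 {n m : ℕ} (r : Fin n → ℝ) (L U : Fin n → ℕ) (hLU : ∀ i, L i ≤ U i)
    (A : Matrix (Fin m) (Fin n) ℝ) (b : Fin m → ℝ) :
    -- arbitrary polyhedral constraints, nondecreasing attractions given by their values on
    -- the inventory levels (in particular those of the form `attraction v ψ`)
    (∀ f : Fin n → ℕ → ℝ, (∀ i, MonotoneOn (f i) (Set.Icc (L i) (U i))) →
      (∀ x : Fin n → ℕ, (∀ i, L i ≤ x i ∧ x i ≤ U i) → 0 < 1 + ∑ i, f i (x i)) →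
      IsMIPFormulation (invLP L U A b f) (invBinary L U) (Sum.elim InvVar.x InvVar.mu)
          (invGraph L U A b f) ∧
        ∀ x : Fin n → ℕ, IsOptimal (invFeasible L U A b) (expectedSales r f) x ↔
          ∃ w, IsOptimal (invIP L U A b f) (invObj L U r) w ∧ ∀ i, w (.x i) = (x i : ℝ)) ∧
    -- box bounds and a cap on the total inventory, `exp ∘ ψ` concave
    (∀ (v : Fin n → ℝ) (ψ : ℝ → ℝ) (cap : ℤ), (∀ i, 0 < v i) →
      {y : Fin n → ℝ | (∀ i, (L i : ℝ) ≤ y i ∧ y i ≤ (U i : ℝ)) ∧ b ≤ A *ᵥ y} =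
        {y : Fin n → ℝ | (∀ i, (L i : ℝ) ≤ y i ∧ y i ≤ (U i : ℝ)) ∧ ∑ i, y i ≤ (cap : ℝ)} →
      (ConcaveOn ℝ (Set.Ici 0) (fun t => Real.exp (ψ t)) ∨
        ∀ i, ConcaveOn ℝ (Set.Icc (L i : ℝ) (U i : ℝ)) (fun t => Real.exp (ψ t)) ∧
          MonotoneOn (fun y : ℕ => Real.exp (ψ y)) (Set.Icc (L i) (U i))) →
      ((invLP L U A b (attraction v ψ)).Nonempty ↔ (invFeasible L U A b).Nonempty) ∧
      ((invFeasible L U A b).Nonempty → ∃ val : ℝ,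
        IsGreatest (invObj L U r '' invLP L U A b (attraction v ψ)) val ∧
        IsGreatest (expectedSales r (attraction v ψ) '' invFeasible L U A b) val) ∧
      ∀ x : Fin n → ℕ,
        IsOptimal (invFeasible L U A b) (expectedSales r (attraction v ψ)) x ↔
          ∃ w ∈ invIP L U A b (attraction v ψ),
            IsOptimal (invLP L U A b (attraction v ψ)) (invObj L U r) w ∧
              ∀ i, w (.x i) = (x i : ℝ)) := by

  refine ⟨fun f hf hpos => ⟨isMIPFormulation_invLP hf hpos hLU, fun x => ?_⟩,
    fun v ψ cap hv hcap hψ => ?_⟩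
  · rw [isOptimal_expectedSales_iff hf hpos hLU r subset_rfl]
    · exact ⟨fun ⟨w, _, h⟩ => ⟨w, h⟩, fun ⟨w, h⟩ => ⟨w, h.1.1, h⟩⟩
    · intro w hw
      obtain ⟨x, hx, -, hmu⟩ := exists_invFeasible_of_mem_invIP hf hpos hLU hw
      exact ⟨x, hx, (invObj_eq_expectedSales r hmu).le⟩
  have hψ' : ∀ i, ConcaveOn ℝ (Set.Icc (L i : ℝ) (U i : ℝ)) (fun t => Real.exp (ψ t)) ∧
      MonotoneOn (fun y : ℕ => Real.exp (ψ y)) (Set.Icc (L i) (U i)) := by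
    rcases hψ with h | h
    · refine fun i => ⟨h.subset (fun t ht => (Nat.cast_nonneg (L i)).trans ht.1)
        (convex_Icc _ _), fun a _ c _ hac => ?_⟩
      exact h.monotoneOn_of_nonneg (fun t => (Real.exp_pos _).le) (Set.mem_Ici.2 (Nat.cast_nonneg a))
        (Set.mem_Ici.2 (Nat.cast_nonneg c)) (Nat.cast_le.2 hac)
    · exact h
  have hf : ∀ i, MonotoneOn (attraction v ψ i) (Set.Icc (L i) (U i)) := fun i a ha c hc hac =>
    mul_le_mul_of_nonneg_left ((hψ' i).2 ha hc hac) (hv i).le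
  have hpos : ∀ x : Fin n → ℕ, (∀ i, L i ≤ x i ∧ x i ≤ U i) →
      0 < 1 + ∑ i, attraction v ψ i (x i) := fun x _ =>
    add_pos_of_pos_of_nonneg one_pos <| Finset.sum_nonneg fun i _ =>
      (mul_pos (hv i) (Real.exp_pos _)).le
  have hinc : ∀ i t t', t ≤ t' → t' < U i - L i →
      levelInc L (attraction v ψ) i t' ≤ levelInc L (attraction v ψ) i t := by
    intro i t t' h h'
    have hU : ((L i + t' + 1 : ℕ) : ℝ) ≤ U i := Nat.cast_le.2 (by omega)
    have ht : (t : ℝ) ≤ t' := Nat.cast_le.2 h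
    have ht0 : (0 : ℝ) ≤ t := Nat.cast_nonneg t
    push_cast at hU
    -- Decreasing increments are concavity with unit step between integer levels.
    have := (hψ' i).1.sub_le_sub_of_le (a := (L i : ℝ) + t) (c := (L i : ℝ) + t') one_pos
      (by linarith) ⟨by linarith, by linarith⟩ ⟨by linarith, hU⟩
    simp only [levelInc, attraction, ← mul_sub]
    push_cast
    exact mul_le_mul_of_nonneg_left this (hv i).le
  have hdom : ∀ w ∈ invLP L U A b (attraction v ψ), ∃ x ∈ invFeasible L U A b,
      invObj L U r w ≤ expectedSales r (attraction v ψ) x := fun w hw =>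
    InvLPFeasible.exists_le_expectedSales hf hpos hLU hinc hcap r hw
  have hlift : ∀ x ∈ invFeasible L U A b,
      invLift L U (attraction v ψ) x ∈ invIP L U A b (attraction v ψ) := fun x hx =>
    invLift_mem_invIP hf hx (hpos x hx.1)
  refine ⟨⟨fun ⟨w, hw⟩ => ?_, fun ⟨x, hx⟩ => ⟨_, (hlift x hx).1⟩⟩, fun hne => ?_,
    isOptimal_expectedSales_iff hf hpos hLU r (fun w hw => hw.1) hdom⟩
  · obtain ⟨x, hx, -⟩ := hdom w hw
    exact ⟨x, hx⟩
  · obtain ⟨x, hx, hmax⟩ := exists_isOptimal_invFeasible (f := attraction v ψ) r hne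
    refine ⟨_, ⟨⟨_, (hlift x hx).1, invObj_eq_expectedSales r fun i => rfl⟩, ?_⟩,
      ⟨x, hx, rfl⟩, ?_⟩
    · rintro _ ⟨w, hw, rfl⟩
      obtain ⟨y, hy, hle⟩ := hdom w hw
      exact hle.trans (hmax hy)
    · rintro _ ⟨y, hy, rfl⟩
      exact hmax hy
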